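/- \textbf{Setting.} Let $\mathcal N$ be a finite set of propositions, identified with their indicator random variables. A Logical Credal Network (LCN) consists of two sets $\mathcal T_U,\mathcal T_D$ of constraints $\alpha\le P(\phi\mid\varphi)\le\beta$, where $\phi$ (conditioned) and $\varphi$ (conditioning) are propositional formulas over $\mathcal N$; the constraint is unconditional if $\varphi$ is a tautology $\top$. Logically equivalent formulas are not distinguished, so the propositions in a formula are those on which its truth value depends. \textbf{Dependency graph.} This directed graph without loops has a node for each proposition, and formula-nodes for the formulas of the constraints; a formula that is a single proposition is represented by that proposition-node. For each constraint there are edges from $\phi$ to each proposition in $\phi$; if $\varphi\ne\top$, also from $\varphi$ to $\phi$ and from each proposition in $\varphi$ to $\varphi$; if the constraint is in $\mathcal T_U$, also from each proposition in $\phi$ to $\phi$. Either (i) each constraint adds its own formula-nodes, or (ii) equal (logically equivalent) formulas share one formula-node. The lcn-parents of $A$ are the propositions $B\neq A$ with a path to $A$ in the dependency graph all of whose intermediate nodes are formula-nodes. The lcn-descendants of $A$ are the propositions reached by a path from $A$ on which no intermediate node is an lcn-parent of $A$. LMC(LCN): each $A$ is independent, given its lcn-parents, of all propositions that are not $A$,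 nor lcn-descendants, nor lcn-parents of $A$. \textbf{Structure.} This graph on $\mathcal N$ is obtained by joining by an undirected edge any two distinct propositions in a formula $\phi$ conditioned in $\mathcal T_U$, and adding, for each constraint, a directed edge from each proposition in $\varphi$ to each other proposition in $\phi$; then a pair $A\leftrightarrows B$ becomes an undirected edge, and if two nodes are joined by both an undirected and a directed edge only the undirected one is kept. Paths follow directed edges forwards and undirected edges in any direction, with all nodes distinct except that the two ends may coincide (a cycle); a path is directed if it has at least one directed edge. A chain graph has no directed cycle. The boundary $\mathrm{bd}(A)$ consists of the parents and neighbors of $A$; the descendants of $A$ are the nodes reached from $A$ by a directed path. LMC(C): each $A$ is independent, given $\mathrm{bd}(A)$, of all nodes that are not $A$, nor descendants of $A$, nor in $\mathrm{bd}(A)$. \textbf{Theorem.} Suppose the structure of an LCN is a chain graph, and let $P$ be a probability distribution on $\{0,1\}^{\mathcal N}$ with all probabilities positive. (1) If the dependency graph is as in (i), then $P$ satisfies LMC(LCN) if and only if $P$ satisfies LMC(C) for the structure. (2) The same equivalence holds for the dependency graph in (ii), provided that no conditioning formula, other than $\top$ and single propositions, is also the conditioned formula of a constraint, except possibly of unconditional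 constraints in $\mathcal T_U$. (3) If $P$ satisfies these conditions, then $$P(x)=\prod_{T}P\bigl(x_T\mid x_{\mathrm{bd}(T)}\bigr)\quad\text{for all }x,$$ where $T$ runs over the chain components of the structure (the connected components after removing directed edges) and $\mathrm{bd}(T)=\bigcup_{A\in T}\mathrm{bd}(A)\setminus T$. Moreover, for each $T$, $P(x_T\mid x_{\mathrm{bd}(T)})=\phi_T(x)/\sum_{y_T}\phi_T(y_T,x_{\mathrm{bd}(T)})$, where $\phi_T$ is a product of positive functions, one for each clique $K$ (maximal set of pairwise joined nodes) and depending only on $x_K$, of the undirected graph on $T\cup\mathrm{bd}(T)$ in which two nodes are joined if they are joined in the structure or both lie in $\mathrm{bd}(T)$. -/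

import Mathlib

namespace CredalNet

/-! ### Mixed graphs, paths, chain graphs -/

section Graphs

variable {V : Type*}

/-- `l` lists the intermediate nodes of a path from `a` to `b` whose consecutive nodes are related
by `step`: all nodes are distinct, except that `a` and `b` may coincide (a cycle). -/
def IsPath (step : V → V → Prop) (a b : V) (l : List V) : Prop :=
  List.IsChain step (a :: (l ++ [b])) ∧ l.Nodup ∧ a ∉ l ∧ b ∉ l

/-- A graph with a set of directed edges and a set of undirected edges, without loops. -/
structure MixedGraph (V : Type*) where
  /-- `dir a b` is the directed edge `a → b`. -/
  dir : V → V → Prop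
  /-- `und a b` is the undirected edge `a ∼ b`. -/
  und : V → V → Prop
  und_symm : ∀ a b, und a b → und b a
  dir_irrefl : ∀ a, ¬ dir a a
  und_irrefl : ∀ a, ¬ und a a

namespace MixedGraph

variable (G : MixedGraph V)

/-- One step of a path: along a directed edge, or across an undirected edge. -/
def step (a b : V) : Prop := G.dir a b ∨ G.und a b

/-- A directed path from `a` to `b`: a path with at least one directed edge. -/
def IsDirectedPath (a b : V) (l : List V) : Prop :=
  IsPath G.step a b l ∧ ∃ u v, [u, v] <:+: (a :: (l ++ [b])) ∧ G.dir u v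

/-- A chain graph is a graph without directed cycles. -/
def IsChainGraph : Prop := ¬ ∃ a l, G.IsDirectedPath a a l

/-- Descendants of `a`. -/
def de (a : V) : Set V := {b | ∃ l, G.IsDirectedPath a b l}

/-- Parents of `a`. -/
def pa (a : V) : Set V := {b | G.dir b a}

/-- Neighbors of `a`. -/
def ne (a : V) : Set V := {b | G.und b a}

/-- Boundary of a node. -/
def bd (a : V) : Set V := G.pa a ∪ G.ne a

/-- Boundary of a set of nodes. -/
def bdSet (B : Set V) : Set V := (⋃ a ∈ B, G.bd a) \ B

/-- The chain component of `a`: the nodes connected to `a` when the directed edges are removed. -/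
def chainComp (a : V) : Set V := {b | Relation.ReflTransGen G.und a b}

open Classical in
/-- The (finite) collection of all chain components. -/
noncomputable def chainComps [Fintype V] : Finset (Set V) := Finset.univ.image G.chainComp

/-- The undirected graph attached to a set `T` of nodes, with nodes in `T ∪ bd(T)`: edges of `G`
between these nodes become undirected, and all pairs of nodes of `bd(T)` are joined. -/
def closureGraph (T : Set V) : SimpleGraph V where
  Adj u v := u ≠ v ∧ u ∈ T ∪ G.bdSet T ∧ v ∈ T ∪ G.bdSet T ∧
    (G.dir u v ∨ G.dir v u ∨ G.und u v ∨ (u ∈ G.bdSet T ∧ v ∈ G.bdSet T))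
  symm := ⟨by
    rintro u v ⟨h1, h2, h3, h4⟩
    refine ⟨h1.symm, h3, h2, ?_⟩
    rcases h4 with h | h | h | h
    · exact Or.inr (Or.inl h)
    · exact Or.inl h
    · exact Or.inr (Or.inr (Or.inl (G.und_symm _ _ h)))
    · exact Or.inr (Or.inr (Or.inr h.symm))⟩
  loopless := ⟨fun _ h => h.1 rfl⟩

end MixedGraph

end Graphs

/-! ### Distributions of indicator variables, conditional independence -/

section Probability

variable {N : Type*}

/-- The event that the variables in `S` take the values they have in `x`. -/
def agree (S : Set N) (x : N → Bool) : Set (N → Bool) := {ω | ∀ i ∈ S, ω i = x i}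

variable [Fintype N] [DecidableEq N]

open Classical in
/-- Probability of an event under the mass function `p`. -/
noncomputable def prob (p : (N → Bool) → ℝ) (E : Set (N → Bool)) : ℝ :=
  ∑ ω ∈ Finset.univ.filter (fun ω => ω ∈ E), p ω

/-- Conditional probability `P(E | F)`; used only when `P(F) > 0`. -/
noncomputable def condProb (p : (N → Bool) → ℝ) (E F : Set (N → Bool)) : ℝ :=
  prob p (E ∩ F) / prob p F

/-- The variables in `X` and those in `Y` are independent given those in `Z`. -/
def CondIndep (p : (N → Bool) → ℝ) (X Y Z : Set N) : Prop :=
  ∀ x y z : N → Bool, 0 < prob p (agree Z z) →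
    condProb p (agree X x ∩ agree Y y) (agree Z z) =
      condProb p (agree X x) (agree Z z) * condProb p (agree Y y) (agree Z z)

namespace MixedGraph

variable (G : MixedGraph N)

/-- Local Markov condition for chain graphs: each node is independent, given its boundary, of all
nodes other than itself, its descendants and its boundary. -/
def LMCC (p : (N → Bool) → ℝ) : Prop :=
  ∀ A, CondIndep p {A} ({A} ∪ G.de A ∪ G.bd A)ᶜ (G.bd A)

open Classical in
/-- The cliques of the undirected graph attached to `T`: maximal sets of pairwise joined nodes. -/
noncomputable def closureCliques (T : Set N) : Finset (Finset N) :=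
  Finset.univ.filter fun K => Maximal
    (fun K' : Finset N => (K' : Set N) ⊆ T ∪ G.bdSet T ∧ (G.closureGraph T).IsClique K') K

/-- `φ` is a product of positive functions, one for each clique of the undirected graph attached
to `T`, each depending only on the variables in its clique. -/
def CliqueFactorizes (T : Set N) (φ : (N → Bool) → ℝ) : Prop :=
  ∃ ψ : Finset N → (N → Bool) → ℝ,
    (∀ K x, 0 < ψ K x) ∧
    (∀ K x y, (∀ i ∈ K, x i = y i) → ψ K x = ψ K y) ∧
    ∀ x, φ x = ∏ K ∈ G.closureCliques T, ψ K x

open Classical in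
/-- Factorization over the chain components: the joint mass function is the product of the
conditional probabilities of the chain components given their boundaries, and each of these is the
normalization of a positive function that factorizes over the cliques of the undirected graph
attached to the component. -/
def ChainFactorizes (p : (N → Bool) → ℝ) : Prop :=
  (∀ x, p x = ∏ T ∈ G.chainComps, condProb p (agree T x) (agree (G.bdSet T) x)) ∧
  ∀ T ∈ G.chainComps, ∃ φ : (N → Bool) → ℝ, G.CliqueFactorizes T φ ∧
    ∀ x, condProb p (agree T x) (agree (G.bdSet T) x) =
      φ x / ∑ y ∈ Finset.univ.filter (fun y : N → Bool => ∀ i, i ∉ T → y i = x i), φ y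

end MixedGraph

end Probability

/-! ### Logical Credal Networks -/

/-- Propositional formulas over the propositions `N`. -/
inductive Formula (N : Type*) where
  | var (A : N) : Formula N
  | top : Formula N
  | neg (φ : Formula N) : Formula N
  | conj (φ ψ : Formula N) : Formula N
  | disj (φ ψ : Formula N) : Formula N

namespace Formula

variable {N : Type*}

/-- Truth value of a formula in an interpretation. -/
def eval : Formula N → (N → Bool) → Bool
  | var A, v => v A
  | top, _ => true
  | neg φ, v => !(φ.eval v)
  | conj φ ψ, v => φ.eval v && ψ.eval v
  | disj φ ψ, v => φ.eval v || ψ.eval v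

/-- Logical equivalence. -/
def Equivalent (φ ψ : Formula N) : Prop := ∀ v, φ.eval v = ψ.eval v

/-- The propositions in a formula. As logically equivalent formulas are not distinguished, these
are the propositions on which the truth value of the formula depends. -/
def atoms (φ : Formula N) : Set N :=
  {A | ∃ v w : N → Bool, (∀ B, B ≠ A → v B = w B) ∧ φ.eval v ≠ φ.eval w}

/-- The formula is (equivalent to) a single proposition. -/
def IsSingle (φ : Formula N) : Prop := ∃ A, φ.Equivalent (var A)

end Formula

/-- A constraint `lower ≤ P(conditioned | conditioning) ≤ upper`. -/
structure Constraint (N : Type*) where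
  lower : ℝ
  upper : ℝ
  conditioned : Formula N
  conditioning : Formula N

/-- The constraint is unconditional: its conditioning formula is a tautology. -/
def Constraint.Unconditional {N : Type*} (c : Constraint N) : Prop :=
  c.conditioning.Equivalent Formula.top

/-- A Logical Credal Network with propositions `N`: two sets of constraints. -/
structure LCN (N : Type*) where
  TU : Set (Constraint N)
  TD : Set (Constraint N)

/-- The node that represents the formula `φ` in a dependency graph: the proposition-node `A` if `φ`
is the single proposition `A`, and otherwise the formula-node with the name `f`. -/
inductive IsNodeOf {N F : Type*} (φ : Formula N) (f : F) : N ⊕ F → Prop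
  | proposition (A : N) : φ.Equivalent (Formula.var A) → IsNodeOf φ f (Sum.inl A)
  | formula : ¬ φ.IsSingle → IsNodeOf φ f (Sum.inr f)

namespace LCN

variable {N : Type*} (L : LCN N)

/-- All constraints of the network. -/
def constraints : Set (Constraint N) := L.TU ∪ L.TD

section Dependency

/- `hd c` and `bd c` name the formula-nodes of the conditioned and of the conditioning formula
of `c`. -/
variable {F : Type*} (hd bd : Constraint N → F)

/-- The edges added to the dependency graph when the constraints are processed. -/
inductive RawEdge : N ⊕ F → N ⊕ F → Prop
  /-- from the conditioning formula to the conditioned formula -/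
  | link (c u v) : c ∈ L.constraints → ¬ c.Unconditional →
      IsNodeOf c.conditioning (bd c) u → IsNodeOf c.conditioned (hd c) v → RawEdge u v
  /-- from the propositions in the conditioning formula to that formula -/
  | intoConditioning (c A u) : c ∈ L.constraints → ¬ c.Unconditional →
      A ∈ c.conditioning.atoms → IsNodeOf c.conditioning (bd c) u → RawEdge (Sum.inl A) u
  /-- from the conditioned formula to the propositions in it -/
  | outOfConditioned (c A v) : c ∈ L.constraints →
      A ∈ c.conditioned.atoms → IsNodeOf c.conditioned (hd c) v → RawEdge v (Sum.inl A)
  /-- for constraints in `TU`, from the propositions in the conditioned formula to that formula -/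
  | intoConditioned (c A v) : c ∈ L.TU →
      A ∈ c.conditioned.atoms → IsNodeOf c.conditioned (hd c) v → RawEdge (Sum.inl A) v

/-- The edges of the dependency graph (a directed graph without loops). -/
def DepEdge (u v : N ⊕ F) : Prop := L.RawEdge hd bd u v ∧ u ≠ v

/-- The lcn-parents of `A`: propositions other than `A` with a path to `A` in the dependency graph
in which all intermediate nodes are formulas. -/
def lcnPa (A : N) : Set N :=
  {B | B ≠ A ∧ ∃ l, IsPath (L.DepEdge hd bd) (Sum.inl B) (Sum.inl A) l ∧
    ∀ u ∈ l, ∃ f : F, u = Sum.inr f}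

/-- The lcn-descendants of `A`: propositions reached from `A` by a path in the dependency graph in
which no intermediate node is an lcn-parent of `A`. -/
def lcnDe (A : N) : Set N :=
  {B | ∃ l, IsPath (L.DepEdge hd bd) (Sum.inl A) (Sum.inl B) l ∧
    ∀ C ∈ L.lcnPa hd bd A, (Sum.inl C : N ⊕ F) ∉ l}

/-- The local Markov condition read off a dependency graph: each proposition is independent, given
its lcn-parents, of all propositions other than itself, its lcn-descendants and its lcn-parents. -/
def LMCOfNames [Fintype N] [DecidableEq N] (p : (N → Bool) → ℝ) : Prop :=
  ∀ A, CondIndep p {A} ({A} ∪ L.lcnDe hd bd A ∪ L.lcnPa hd bd A)ᶜ (L.lcnPa hd bd A)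

end Dependency

/-- LMC(LCN) for the dependency graph in which every constraint adds its own formula-nodes. -/
def LMCSeparate [Fintype N] [DecidableEq N] (p : (N → Bool) → ℝ) : Prop :=
  L.LMCOfNames (F := Constraint N × Bool) (fun c => (c, true)) (fun c => (c, false)) p

/-- LMC(LCN) for the dependency graph in which logically equivalent formulas share one
formula-node; that node is named by the common truth function. -/
def LMCShared [Fintype N] [DecidableEq N] (p : (N → Bool) → ℝ) : Prop :=
  L.LMCOfNames (F := (N → Bool) → Bool) (fun c => c.conditioned.eval)
    (fun c => c.conditioning.eval) p

/-- No formula-node is shared between a conditioning and a conditioned role: a conditioning formula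
(neither a tautology nor a single proposition) is not the conditioned formula of any constraint,
except possibly of unconditional constraints in `TU`. -/
def RolesSeparated : Prop :=
  ∀ c ∈ L.constraints, ∀ c' ∈ L.constraints,
    ¬ c.Unconditional → ¬ c.conditioning.IsSingle →
    c'.conditioned.Equivalent c.conditioning → c' ∈ L.TU ∧ c'.Unconditional

/-- Undirected edges: between any two propositions in a formula conditioned in `TU`. -/
def undEdge (A B : N) : Prop :=
  A ≠ B ∧ ∃ c ∈ L.TU, A ∈ c.conditioned.atoms ∧ B ∈ c.conditioned.atoms

/-- Directed edges: from each proposition in the conditioning formula of a constraint to each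
proposition in its conditioned formula. -/
def dirEdge (A B : N) : Prop :=
  A ≠ B ∧ ∃ c ∈ L.constraints, A ∈ c.conditioning.atoms ∧ B ∈ c.conditioned.atoms

/-- The structure of the network: a pair of directed edges in both directions is replaced by an
undirected edge, and of multiple edges joining two nodes a single one is kept, which is the
undirected one if there is one. -/
def structureGraph : MixedGraph N where
  und A B := L.undEdge A B ∨ (L.dirEdge A B ∧ L.dirEdge B A)
  dir A B := L.dirEdge A B ∧ ¬ L.dirEdge B A ∧ ¬ L.undEdge A B
  und_symm := by
    rintro A B (⟨h, c, hc, hA, hB⟩ | ⟨h1, h2⟩)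
    · exact Or.inl ⟨h.symm, c, hc, hB, hA⟩
    · exact Or.inr ⟨h2, h1⟩
  dir_irrefl := fun _ h => h.1.1 rfl
  und_irrefl := by
    rintro A (h | h)
    · exact h.1 rfl
    · exact h.1.1 rfl

end LCN

end CredalNet

/-! The lcn-parents of `A` are exactly its boundary in the structure (`lcnPa_eq_bd`). A walk through
formula-nodes from a proposition `B` never forgets `B`: every formula-node it visits either contains
`B` in a suitable role or is conditioned on a formula containing `B`, so the walk ends at `B` or at
a proposition joined to `B` in the structure. In case (ii) this survives because a node shared
between the two roles comes only from unconditional constraints in `TU`, which add no new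
predecessors.

The lcn-descendants lie in the union of `A`, its descendants and its boundary (`lcnDe_subset`), but
may omit descendants reached only through the boundary. Hence LMC(LCN) asserts independence from a
larger set, and it implies LMC(C) by marginalization.

The converse goes through the factorization. Under LMC(C), the log-marginal of the non-descendants
of a component `T` has no interaction between a node of `T` and a node outside its boundary. Möbius
inversion, as in the Hammersley-Clifford theorem, then writes this marginal as clique functions
times a factor free of `x_T` (`exists_cliqueFactorizes`). So `T` given its boundary is a normalized
clique product, and peeling off terminal components factorizes the marginal of every set closed
under boundaries (`prob_agree_eq_prod`); the whole node set gives (3). The nodes that LMC(LCN)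
declares independent of `A`, together with `A` and its boundary, form such a set without children of
`A`. There `A` enters only through cliques of its own component containing `A`, which gives the
independence (`condIndep_of_lower`). -/

namespace CredalNet

/-! ### Walks, paths and reachability -/

section Walks

variable {V : Type*} {r : V → V → Prop}

open Relation

/-- Loops are cut out of the walk. Recording `l' ⊆ l` lets the path inherit any avoidance or
formula-node condition on intermediate nodes. -/
theorem exists_isPath_of_isChain {b : V} : ∀ (l : List V) (a : V), a ≠ b →
    List.IsChain r (a :: (l ++ [b])) → ∃ l', l' ⊆ l ∧ IsPath r a b l' := by
  intro l
  induction l with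
  | nil =>
    intro a hab h
    exact ⟨[], List.Subset.refl _, h, by simp, by simp, by simp⟩
  | cons c t ih =>
    intro a hab h
    rw [List.cons_append, List.isChain_cons_cons] at h
    obtain ⟨hac, hc⟩ := h
    by_cases hcb : c = b
    · subst hcb
      exact ⟨[], by simp, by simpa using hac, by simp, by simp, by simp⟩
    obtain ⟨l', hl', hp, hnd, hcl, hbl⟩ := ih c hcb hc
    by_cases hca : a = c
    · subst hca
      exact ⟨l', fun x hx => List.mem_cons_of_mem _ (hl' hx), hp, hnd, hcl, hbl⟩
    by_cases hal : a ∈ l'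
    · obtain ⟨l1, l2, rfl⟩ := List.append_of_mem hal
      refine ⟨l2, fun x hx => List.mem_cons_of_mem _ (hl' (by simp [hx])), ?_, ?_, ?_, ?_⟩
      · have : a :: (l2 ++ [b]) <:+ c :: (l1 ++ a :: l2 ++ [b]) := ⟨c :: l1, by simp⟩
        exact hp.suffix this
      · exact (List.nodup_cons.1 (List.nodup_append.1 hnd).2.1).2
      · exact (List.nodup_cons.1 (List.nodup_append.1 hnd).2.1).1
      · intro hb
        exact hbl (by simp [hb])
    · refine ⟨c :: l', ?_, ?_, ?_, ?_, ?_⟩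
      · intro x hx
        rcases List.mem_cons.1 hx with rfl | hx
        · simp
        · exact List.mem_cons_of_mem _ (hl' hx)
      · rw [List.cons_append, List.isChain_cons_cons]
        exact ⟨hac, hp⟩
      · exact List.nodup_cons.2 ⟨hcl, hnd⟩
      · simp [hca, hal]
      · simp [Ne.symm hcb, hbl]

theorem reflTransGen_of_isChain {b : V} : ∀ (l : List V) (a : V),
    List.IsChain r (a :: (l ++ [b])) → ReflTransGen r a b := by
  intro l
  induction l with
  | nil => intro a h; exact ReflTransGen.single (by simpa using h)
  | cons c t ih =>
    intro a h
    rw [List.cons_append, List.isChain_cons_cons] at h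
    exact ReflTransGen.head h.1 (ih c h.2)

theorem exists_isChain_of_reflTransGen {a b : V} (h : ReflTransGen r a b) :
    a = b ∨ ∃ l, List.IsChain r (a :: (l ++ [b])) := by
  induction h using ReflTransGen.head_induction_on with
  | refl => exact Or.inl rfl
  | head h1 _ ih =>
    rcases ih with rfl | ⟨l, hl⟩
    · exact Or.inr ⟨[], by simpa using h1⟩
    · exact Or.inr ⟨_ :: l, by rw [List.cons_append, List.isChain_cons_cons]; exact ⟨h1, hl⟩⟩

theorem exists_isPath_of_reflTransGen {a b : V} (h : ReflTransGen r a b) (hab : a ≠ b) :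
    ∃ l, IsPath r a b l := by
  rcases exists_isChain_of_reflTransGen h with rfl | ⟨l, hl⟩
  · exact absurd rfl hab
  · obtain ⟨l', -, h'⟩ := exists_isPath_of_isChain l a hab hl
    exact ⟨l', h'⟩

theorem reflTransGen_of_infix {b u v : V} : ∀ (l : List V) (a : V),
    List.IsChain r (a :: (l ++ [b])) → [u, v] <:+: (a :: (l ++ [b])) →
    ReflTransGen r a u ∧ ReflTransGen r v b := by
  intro l
  induction l with
  | nil =>
    intro a _ hi
    have := hi.eq_of_length (by simp)
    simp only [List.nil_append, List.cons.injEq, and_true] at this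
    obtain ⟨rfl, rfl⟩ := this
    exact ⟨.refl, .refl⟩
  | cons c t ih =>
    intro a h hi
    rw [List.cons_append, List.isChain_cons_cons] at h
    rcases List.infix_cons_iff.1 hi with hi | hi
    · rw [List.cons_append, List.cons_prefix_cons, List.cons_prefix_cons] at hi
      obtain ⟨rfl, rfl, -⟩ := hi
      exact ⟨.refl, reflTransGen_of_isChain _ _ h.2⟩
    · obtain ⟨h1, h2⟩ := ih c h.2 hi
      exact ⟨ReflTransGen.head h.1 h1, h2⟩

end Walks

/-! ### Chain graphs in terms of reachability -/

namespace MixedGraph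

open Relation

variable {V : Type*} {G : MixedGraph V}

/-- A walk back, shortened to a path, would close the edge into a directed cycle. Later arguments
use acyclicity only in this form. -/
theorem IsChainGraph.not_reach_of_dir (h : G.IsChainGraph) {u v : V} (huv : G.dir u v) :
    ¬ ReflTransGen G.step v u := by
  intro hr
  have hne : v ≠ u := by
    rintro rfl
    exact G.dir_irrefl _ huv
  obtain ⟨l, hl, hnd, h1, h2⟩ := exists_isPath_of_reflTransGen hr hne
  refine h ⟨u, v :: l, ⟨?_, List.nodup_cons.2 ⟨h1, hnd⟩, ?_, ?_⟩, u, v, ?_, huv⟩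
  · rw [List.cons_append, List.isChain_cons_cons]
    exact ⟨Or.inl huv, hl⟩
  · simp [hne.symm, h2]
  · simp [hne.symm, h2]
  · exact ⟨[], l ++ [u], by simp⟩

theorem reach_symm_of_und {a b : V} (h : ReflTransGen G.und a b) : ReflTransGen G.und b a :=
  by
  have : Std.Symm G.und := ⟨G.und_symm⟩
  exact symm h

theorem reach_of_und {a b : V} (h : ReflTransGen G.und a b) : ReflTransGen G.step a b :=
  ReflTransGen.mono (fun _ _ => Or.inr) a b h

theorem IsChainGraph.mem_de_iff (h : G.IsChainGraph) {a b : V} :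
    b ∈ G.de a ↔ ReflTransGen G.step a b ∧ ¬ ReflTransGen G.step b a := by
  constructor
  · rintro ⟨l, ⟨hl, -⟩, u, v, hi, huv⟩
    refine ⟨reflTransGen_of_isChain _ _ hl, fun hba => ?_⟩
    obtain ⟨h1, h2⟩ := reflTransGen_of_infix _ _ hl hi
    exact h.not_reach_of_dir huv (h2.trans (hba.trans h1))
  · rintro ⟨hab, hba⟩
    have hne : a ≠ b := by
      rintro rfl
      exact hba .refl
    obtain ⟨l, hl⟩ := exists_isPath_of_reflTransGen hab hne
    refine ⟨l, hl, ?_⟩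
    -- Without a directed edge the path is undirected, hence reversible, and `b` would reach `a`.
    by_contra hno
    push Not at hno
    refine hba (reach_of_und (reach_symm_of_und (reflTransGen_of_isChain l a ?_)))
    rw [List.isChain_iff_forall_rel_of_append_cons_cons]
    intro u v l₁ l₂ heq
    have hi : [u, v] <:+: a :: (l ++ [b]) := ⟨l₁, l₂, by simp [heq]⟩
    exact (List.isChain_iff_forall_rel_of_append_cons_cons.1 hl.1 heq).resolve_left (hno u v hi)

/-- Each step of a walk between mutually reachable nodes lies on a closed walk, so it cannot be
directed. -/
theorem IsChainGraph.mem_chainComp_iff (h : G.IsChainGraph) {a b : V} :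
    b ∈ G.chainComp a ↔ ReflTransGen G.step a b ∧ ReflTransGen G.step b a := by
  constructor
  · intro hb
    exact ⟨reach_of_und hb, reach_of_und (reach_symm_of_und hb)⟩
  · rintro ⟨hab, hba⟩
    change ReflTransGen G.und a b
    induction hab with
    | refl => exact .refl
    | tail h1 h2 ih =>
      have h3 := hba
      refine (ih (ReflTransGen.head h2 hba)).tail (h2.resolve_left fun hd => ?_)
      exact h.not_reach_of_dir hd (hba.trans h1)

end MixedGraph

set_option linter.unusedSectionVars false

/-! ### Marginals and conditional independence for positive distributions -/

section Sums

variable {N : Type*} [Fintype N] [DecidableEq N]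

open Classical in
/-- The sum of `f` over all configurations that agree with `x` outside `D`. -/
noncomputable def sumOver (D : Set N) (f : (N → Bool) → ℝ) (x : N → Bool) : ℝ :=
  ∑ y ∈ Finset.univ.filter (fun y : N → Bool => ∀ i, i ∉ D → y i = x i), f y

open Classical in
theorem sumOver_sumOver {D E : Set N} (h : Disjoint D E) (f : (N → Bool) → ℝ) (x : N → Bool) :
    sumOver D (sumOver E f) x = sumOver (D ∪ E) f x := by
  unfold sumOver
  -- The inner configuration `z` determines the outer one: it is `z` on `D` and `x` elsewhere.
  rw [Finset.sum_comm' (t' := Finset.univ.filter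
      (fun z : N → Bool => ∀ i, i ∉ D ∪ E → z i = x i))
    (s' := fun z => {fun i => if i ∈ D then z i else x i})]
  · simp
  · intro y z
    simp only [Finset.mem_filter, Finset.mem_univ, true_and, Finset.mem_singleton, Set.mem_union,
      not_or]
    constructor
    · rintro ⟨h1, h2⟩
      refine ⟨?_, fun i hi => (h2 i hi.2).trans (h1 i hi.1)⟩
      funext i
      by_cases hi : i ∈ D
      · simp [hi, h2 i (fun hE => Set.disjoint_left.1 h hi hE)]
      · simp [hi, h1 i hi]
    · rintro ⟨rfl, h2⟩
      refine ⟨fun i hi => by simp [hi], fun i hi => ?_⟩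
      by_cases hD : i ∈ D
      · simp [hD]
      · simp [hD, h2 i ⟨hD, hi⟩]

open Classical in
theorem sumOver_mul_left {D : Set N} {g : (N → Bool) → ℝ} (hg : DependsOn g Dᶜ)
    (f : (N → Bool) → ℝ) (x : N → Bool) :
    sumOver D (fun y => g y * f y) x = g x * sumOver D f x := by
  unfold sumOver
  rw [Finset.mul_sum]
  refine Finset.sum_congr rfl fun y hy => ?_
  rw [Finset.mem_filter] at hy
  change g y * f y = g x * f y
  rw [hg (x := y) (y := x) fun i hi => hy.2 i hi]

open Classical in
theorem dependsOn_sumOver {f : (N → Bool) → ℝ} {S : Set N} (hf : DependsOn f S) (D : Set N) :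
    DependsOn (sumOver D f) (S \ D) := by
  intro x y hxy
  unfold sumOver
  refine Finset.sum_nbij' (fun z i => if i ∈ D then z i else y i)
    (fun z i => if i ∈ D then z i else x i) ?_ ?_ ?_ ?_ ?_
  · intro z _
    simp +contextual
  · intro z _
    simp +contextual
  · intro z hz
    simp only [Finset.mem_filter, Finset.mem_univ, true_and] at hz
    funext i
    by_cases hi : i ∈ D <;> simp [hi, hz]
  · intro z hz
    simp only [Finset.mem_filter, Finset.mem_univ, true_and] at hz
    funext i
    by_cases hi : i ∈ D <;> simp [hi, hz]
  · intro z hz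
    simp only [Finset.mem_filter, Finset.mem_univ, true_and] at hz
    refine hf fun i hi => ?_
    by_cases hD : i ∈ D
    · simp [hD]
    · simp [hD, hz i hD, hxy i ⟨hi, hD⟩]

theorem dependsOn_prod {ι : Type*} {s : Finset ι} {f : ι → (N → Bool) → ℝ} {S : Set N}
    (h : ∀ i ∈ s, DependsOn (f i) S) : DependsOn (fun x => ∏ i ∈ s, f i x) S := by
  intro x y hxy
  exact Finset.prod_congr rfl fun i hi => h i hi hxy

theorem prob_agree_eq_sumOver (p : (N → Bool) → ℝ) (S : Set N) (x : N → Bool) :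
    prob p (agree S x) = sumOver Sᶜ p x := by
  unfold prob sumOver agree
  refine Finset.sum_congr ?_ fun _ _ => rfl
  ext y
  simp

theorem prob_agree_sum {p : (N → Bool) → ℝ} {R D S : Set N} (hRD : Disjoint R D) (hS : R ∪ D = S)
    (x : N → Bool) : prob p (agree R x) = sumOver D (fun y => prob p (agree S y)) x := by
  simp only [prob_agree_eq_sumOver]
  rw [sumOver_sumOver]
  · congr 1
    subst hS
    ext i
    have : i ∈ R → i ∉ D := fun hi => Set.disjoint_left.1 hRD hi
    simp only [Set.mem_compl_iff, Set.mem_union]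
    tauto
  · subst hS
    rw [Set.disjoint_left]
    intro i hi
    simp [hi]

theorem dependsOn_prob_agree (p : (N → Bool) → ℝ) (S : Set N) :
    DependsOn (fun x => prob p (agree S x)) S := by
  intro x y hxy
  have : agree S x = agree S y := by
    ext ω
    exact forall₂_congr fun i hi => by rw [hxy i hi]
  simp only [this]

theorem prob_agree_pos {p : (N → Bool) → ℝ} (hpos : ∀ x, 0 < p x) (S : Set N) (x : N → Bool) :
    0 < prob p (agree S x) := by
  classical
  refine Finset.sum_pos (fun y _ => hpos y) ⟨x, ?_⟩
  exact Finset.mem_filter.2 ⟨Finset.mem_univ _, fun _ _ => rfl⟩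

theorem agree_inter (S R : Set N) (x : N → Bool) : agree S x ∩ agree R x = agree (S ∪ R) x := by
  ext ω
  simp only [agree, Set.mem_inter_iff, Set.mem_ofPred_eq, Set.mem_union]
  constructor
  · rintro ⟨h1, h2⟩ i (hi | hi)
    exacts [h1 i hi, h2 i hi]
  · intro h
    exact ⟨fun i hi => h i (Or.inl hi), fun i hi => h i (Or.inr hi)⟩

theorem condProb_agree (p : (N → Bool) → ℝ) (S R : Set N) (x : N → Bool) :
    condProb p (agree S x) (agree R x) = prob p (agree (S ∪ R) x) / prob p (agree R x) := by
  rw [condProb, agree_inter]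

theorem agree_congr {S : Set N} {x y : N → Bool} (h : ∀ i ∈ S, x i = y i) :
    agree S x = agree S y := by
  ext ω
  exact forall₂_congr fun i hi => by rw [h i hi]

open Classical in
/-- For disjoint sets of variables and positive distributions, conditional independence is a
product formula for marginals. -/
theorem condIndep_iff {p : (N → Bool) → ℝ} (hpos : ∀ x, 0 < p x) {X Y Z : Set N}
    (hXY : Disjoint X Y) (hXZ : Disjoint X Z) (hYZ : Disjoint Y Z) :
    CondIndep p X Y Z ↔ ∀ w, prob p (agree (X ∪ Y ∪ Z) w) * prob p (agree Z w) =
      prob p (agree (X ∪ Z) w) * prob p (agree (Y ∪ Z) w) := by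
  have key : ∀ w, (condProb p (agree X w ∩ agree Y w) (agree Z w) =
      condProb p (agree X w) (agree Z w) * condProb p (agree Y w) (agree Z w)) ↔
      prob p (agree (X ∪ Y ∪ Z) w) * prob p (agree Z w) =
      prob p (agree (X ∪ Z) w) * prob p (agree (Y ∪ Z) w) := by
    intro w
    have hZ := (prob_agree_pos hpos Z w).ne'
    rw [agree_inter, condProb_agree, condProb_agree, condProb_agree, div_mul_div_comm,
      div_eq_div_iff hZ (mul_ne_zero hZ hZ), ← mul_assoc]
    exact mul_left_inj' hZ
  constructor
  · intro h w
    exact (key w).1 (h w w w (prob_agree_pos hpos Z w))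
  · intro h x y z _
    -- Disjointness allows the three separate assignments to be glued into one.
    let w : N → Bool := fun i => if i ∈ X then x i else if i ∈ Y then y i else z i
    have hx : agree X x = agree X w := agree_congr fun i hi => by simp [w, hi]
    have hy : agree Y y = agree Y w := agree_congr fun i hi => by
      simp [w, hi, Set.disjoint_right.1 hXY hi]
    have hz : agree Z z = agree Z w := agree_congr fun i hi => by
      simp [w, Set.disjoint_right.1 hXZ hi, Set.disjoint_right.1 hYZ hi]
    rw [hx, hy, hz]
    exact (key w).2 (h w)

theorem CondIndep.mono {p : (N → Bool) → ℝ} (hpos : ∀ x, 0 < p x) {X Y Y' Z : Set N}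
    (hXY : Disjoint X Y) (hXZ : Disjoint X Z) (hYZ : Disjoint Y Z) (hY : Y' ⊆ Y)
    (h : CondIndep p X Y Z) : CondIndep p X Y' Z := by
  rw [condIndep_iff hpos hXY hXZ hYZ] at h
  rw [condIndep_iff hpos (hXY.mono_right hY) hXZ (hYZ.mono_left hY)]
  intro w
  have hX' := Set.disjoint_left.1 hXY
  have hZ' := Set.disjoint_left.1 hYZ
  have h1 : prob p (agree (X ∪ Y' ∪ Z) w) =
      sumOver (Y \ Y') (fun y => prob p (agree (X ∪ Y ∪ Z) y)) w := by
    refine prob_agree_sum ?_ ?_ w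
    · rw [Set.disjoint_left]
      rintro i ((hi | hi) | hi) ⟨h1, h2⟩
      exacts [hX' hi h1, h2 hi, hZ' h1 hi]
    · ext i
      have := @hY i
      simp only [Set.mem_union, Set.mem_sdiff]
      tauto
  have h2 : prob p (agree (Y' ∪ Z) w) =
      sumOver (Y \ Y') (fun y => prob p (agree (Y ∪ Z) y)) w := by
    refine prob_agree_sum ?_ ?_ w
    · rw [Set.disjoint_left]
      rintro i (hi | hi) ⟨h1, h2⟩
      exacts [h2 hi, hZ' h1 hi]
    · ext i
      have := @hY i
      simp only [Set.mem_union, Set.mem_sdiff]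
      tauto
  have h3 : DependsOn (fun x => prob p (agree Z x)) (Y \ Y')ᶜ := fun x y hxy =>
    dependsOn_prob_agree p Z fun i hi => hxy i fun h => hZ' h.1 hi
  have h4 : DependsOn (fun x => prob p (agree (X ∪ Z) x)) (Y \ Y')ᶜ := by
    refine fun x y hxy => dependsOn_prob_agree p (X ∪ Z) fun i hi => hxy i fun h => ?_
    rcases hi with hi | hi
    exacts [hX' hi h.1, hZ' h.1 hi]
  -- The product formula for `Y` is summed over the values on `Y \ Y'`; the two marginals free of
  -- these variables come out of the sums.
  rw [h1, h2, mul_comm]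
  refine (sumOver_mul_left h3 _ w).symm.trans (Eq.trans ?_ (sumOver_mul_left h4 _ w))
  congr 1
  funext y
  rw [mul_comm, h]

/-- A factorization of a marginal yields conditional independence. -/
theorem condIndep_of_factorization {p : (N → Bool) → ℝ} (hpos : ∀ x, 0 < p x) {X Y Z : Set N}
    (hXY : Disjoint X Y) (hXZ : Disjoint X Z) (hYZ : Disjoint Y Z) {α β : (N → Bool) → ℝ}
    (hα : DependsOn α Yᶜ) (hβ : DependsOn β Xᶜ)
    (h : ∀ x, prob p (agree (X ∪ Y ∪ Z) x) = α x * β x) : CondIndep p X Y Z := by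
  rw [condIndep_iff hpos hXY hXZ hYZ]
  have h1 : ∀ x, prob p (agree (X ∪ Z) x) = α x * sumOver Y β x := by
    intro x
    rw [prob_agree_sum (p := p) (D := Y) (S := X ∪ Y ∪ Z), ← sumOver_mul_left hα]
    · simp only [h]
    · exact Set.disjoint_union_left.2 ⟨hXY, hYZ.symm⟩
    · exact Set.union_right_comm _ _ _
  have h2 : ∀ x, prob p (agree (Y ∪ Z) x) = β x * sumOver X α x := by
    intro x
    rw [prob_agree_sum (p := p) (D := X) (S := X ∪ Y ∪ Z), ← sumOver_mul_left hβ]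
    · simp only [h, mul_comm]
    · exact Set.disjoint_union_left.2 ⟨hXY.symm, hXZ.symm⟩
    · rw [Set.union_comm, Set.union_assoc]
  have h3 : ∀ x, prob p (agree Z x) = sumOver X α x * sumOver Y β x := by
    intro x
    rw [prob_agree_sum (p := p) (D := Y) (S := Y ∪ Z) hYZ.symm (Set.union_comm _ _),
      ← sumOver_mul_left]
    · simp only [h2, mul_comm]
    · refine fun x y hxy => dependsOn_sumOver hα X fun i hi => hxy i hi.1
  intro w
  rw [h, h1, h2, h3]
  ring

end Sums

/-! ### Möbius inversion and interactions -/

section Interaction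

variable {N : Type*} [Fintype N] [DecidableEq N]

/-- The configuration that equals `x` on `J` and is false elsewhere. -/
def mask (J : Finset N) (x : N → Bool) : N → Bool := fun i => if i ∈ J then x i else false

/-- The interaction of the variables in `K` in the function `f`, relative to the reference
configuration in which all variables are false. -/
noncomputable def interaction (f : (N → Bool) → ℝ) (K : Finset N) (x : N → Bool) : ℝ :=
  ∑ J ∈ K.powerset, (-1) ^ (K \ J).card * f (mask J x)

theorem dependsOn_interaction (f : (N → Bool) → ℝ) (K : Finset N) :
    DependsOn (interaction f K) (K : Set N) := by
  intro x y hxy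
  refine Finset.sum_congr rfl fun J hJ => ?_
  have : mask J x = mask J y := by
    funext i
    by_cases hi : i ∈ J
    · simp [mask, hi, hxy i (Finset.mem_powerset.1 hJ hi)]
    · simp [mask, hi]
  rw [this]

theorem sum_interaction (f : (N → Bool) → ℝ) (x : N → Bool) :
    ∑ K : Finset N, interaction f K x = f x := by
  unfold interaction
  -- After the exchange, the coefficient of `f (mask J x)` is an alternating sum over all `K ⊇ J`,
  -- which vanishes unless `J` is everything.
  rw [Finset.sum_comm' (t' := Finset.univ) (s' := fun J => Finset.univ.filter (J ⊆ ·))]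
  · have : ∀ J : Finset N, ∑ K ∈ Finset.univ.filter (J ⊆ ·), (-1 : ℝ) ^ (K \ J).card =
        if J = Finset.univ then 1 else 0 := by
      intro J
      have h1 : ∑ K ∈ Finset.univ.filter (J ⊆ ·), (-1 : ℝ) ^ (K \ J).card =
          ∑ L ∈ Jᶜ.powerset, (-1 : ℝ) ^ L.card := by
        refine Finset.sum_nbij' (fun K => K \ J) (fun L => L ∪ J) ?_ ?_ ?_ ?_ ?_
        · intro K _
          simp only [Finset.mem_powerset]
          intro i hi
          simp at hi ⊢
          exact hi.2
        · intro L _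
          simp
        · intro K hK
          simp at hK
          exact Finset.sdiff_union_of_subset hK
        · intro L hL
          simp only [Finset.mem_powerset] at hL
          have : Disjoint L J := by
            rw [Finset.disjoint_left]
            intro i hi
            simpa using hL hi
          exact Finset.union_sdiff_cancel_right this
        · intro K _
          rfl
      have h2 := Finset.sum_powerset_neg_one_pow_card (x := Jᶜ)
      have h3 : (∑ L ∈ Jᶜ.powerset, (-1 : ℝ) ^ L.card) = if Jᶜ = ∅ then 1 else 0 := by
        exact_mod_cast congrArg (Int.cast (R := ℝ)) h2
      rw [h1, h3]
      simp
    simp only [← Finset.sum_mul, this]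
    simp [show mask Finset.univ x = x from funext fun i => by simp [mask]]
  · intro K J
    simp

theorem interaction_add (f g : (N → Bool) → ℝ) (K : Finset N) (x : N → Bool) :
    interaction (fun y => f y + g y) K x = interaction f K x + interaction g K x := by
  simp only [interaction, mul_add, Finset.sum_add_distrib]

/-- The terms of `J` and `insert a J` have the same value of `f` and opposite signs. -/
theorem interaction_eq_zero {f : (N → Bool) → ℝ} {a : N} (hf : DependsOn f {a}ᶜ) {K : Finset N}
    (ha : a ∈ K) (x : N → Bool) : interaction f K x = 0 := by
  obtain ⟨L, haL, rfl⟩ : ∃ L, a ∉ L ∧ insert a L = K :=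
    ⟨K.erase a, Finset.notMem_erase _ _, Finset.insert_erase ha⟩
  rw [interaction, Finset.sum_powerset_insert haL, ← Finset.sum_add_distrib]
  refine Finset.sum_eq_zero fun J hJ => ?_
  have hJL := Finset.mem_powerset.1 hJ
  have haJ : a ∉ J := fun h => haL (hJL h)
  have h1 : f (mask (insert a J) x) = f (mask J x) := by
    refine hf fun i hi => ?_
    have : i ≠ a := hi
    simp [mask, this]
  have h2 : insert a L \ J = insert a (L \ J) := Finset.insert_sdiff_of_notMem _ haJ
  have h3 : insert a L \ insert a J = L \ J := by
    ext i
    by_cases hi : i = a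
    · subst hi; simp [haL]
    · simp [hi]
  rw [h1, h2, h3, Finset.card_insert_of_notMem (by simp [haL])]
  ring

end Interaction

/-! ### Factorization of distributions that satisfy LMC(C) -/

namespace MixedGraph

open Relation

variable {N : Type*} [Fintype N] [DecidableEq N] {G : MixedGraph N} {p : (N → Bool) → ℝ}

/-- Thanks to this, the local conditions at all nodes of a component speak about one and the same
marginal, that of the common non-descendants. -/
theorem IsChainGraph.de_eq_of_mem_chainComp (h : G.IsChainGraph) {a b : N}
    (hb : b ∈ G.chainComp a) : G.de b = G.de a := by
  rw [h.mem_chainComp_iff] at hb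
  ext c
  rw [h.mem_de_iff, h.mem_de_iff]
  exact ⟨fun ⟨h1, h2⟩ => ⟨hb.1.trans h1, fun h3 => h2 (h3.trans hb.1)⟩,
    fun ⟨h1, h2⟩ => ⟨hb.2.trans h1, fun h3 => h2 (h3.trans hb.2)⟩⟩

theorem IsChainGraph.not_mem_de_of_mem_bd (h : G.IsChainGraph) {a b : N} (hb : b ∈ G.bd a) :
    b ∉ G.de a := by
  rw [h.mem_de_iff]
  exact fun hd => hd.2 (.single hb)

theorem IsChainGraph.not_mem_de_self (h : G.IsChainGraph) (a : N) : a ∉ G.de a := by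
  rw [h.mem_de_iff]
  exact fun hd => hd.2 .refl

theorem not_mem_bd_self (a : N) : a ∉ G.bd a := by
  rintro (h | h)
  exacts [G.dir_irrefl _ h, G.und_irrefl _ h]

theorem bd_subset_chainComp_union {a b : N} (hb : b ∈ G.chainComp a) :
    G.bd b ⊆ G.chainComp a ∪ G.bdSet (G.chainComp a) := by
  intro c hc
  by_cases hcT : c ∈ G.chainComp a
  · exact Or.inl hcT
  · exact Or.inr ⟨Set.mem_iUnion₂.2 ⟨b, hb, hc⟩, hcT⟩

theorem IsChainGraph.not_dir_chainComp (h : G.IsChainGraph) {a b c : N}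
    (hb : b ∈ G.chainComp a) (hc : c ∈ G.chainComp a ∪ G.bdSet (G.chainComp a)) :
    ¬ G.dir b c := by
  intro hbc
  rw [h.mem_chainComp_iff] at hb
  refine h.not_reach_of_dir hbc ?_
  rcases hc with hc | ⟨hc, -⟩
  · rw [h.mem_chainComp_iff] at hc
    exact hc.2.trans hb.1
  · obtain ⟨d, hd, hcd⟩ := Set.mem_iUnion₂.1 hc
    rw [h.mem_chainComp_iff] at hd
    exact ReflTransGen.head hcd (hd.2.trans hb.1)

/-- The local Markov condition removes the interactions of a node of a chain component with the
non-descendants outside its boundary. -/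
theorem LMCC.interaction_eq_zero (h : G.IsChainGraph) (hpos : ∀ x, 0 < p x) (hL : G.LMCC p)
    {a b c : N} (hb : b ∈ G.chainComp a) (hcb : c ≠ b) (hc : c ∉ G.bd b) {K : Finset N}
    (hbK : b ∈ K) (hcK : c ∈ K) (x : N → Bool) :
    interaction (fun y => Real.log (prob p (agree (G.de a)ᶜ y))) K x = 0 := by
  have hde := h.de_eq_of_mem_chainComp hb
  set Y : Set N := ({b} ∪ G.de b ∪ G.bd b)ᶜ with hY
  have hCI := (condIndep_iff hpos (X := {b}) (Y := Y) (Z := G.bd b)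
    (by simp [hY]) (by simpa using not_mem_bd_self b)
    (by rw [Set.disjoint_left]; intro i hi hi'; exact hi (Or.inr hi'))).1 (hL b)
  have hU : {b} ∪ Y ∪ G.bd b = (G.de a)ᶜ := by
    rw [← hde]
    ext i
    have h1 := h.not_mem_de_of_mem_bd (a := b) (b := i)
    have h2 : i = b → i ∉ G.de b := by
      rintro rfl
      exact h.not_mem_de_self _
    simp only [hY, Set.mem_union, Set.mem_compl_iff, Set.mem_singleton_iff]
    grind
  -- Logarithm of the product formula for the independence at `b`: the bracket does not involve `b`,
  -- and the last term does not involve `c`.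
  have hf : (fun y => Real.log (prob p (agree (G.de a)ᶜ y))) = fun y =>
      (Real.log (prob p (agree (Y ∪ G.bd b) y)) - Real.log (prob p (agree (G.bd b) y))) +
        Real.log (prob p (agree ({b} ∪ G.bd b) y)) := by
    funext y
    have h1 := hCI y
    rw [hU] at h1
    have h2 := congrArg Real.log h1
    rw [Real.log_mul (prob_agree_pos hpos _ _).ne' (prob_agree_pos hpos _ _).ne',
      Real.log_mul (prob_agree_pos hpos _ _).ne' (prob_agree_pos hpos _ _).ne'] at h2
    linarith
  rw [hf, interaction_add, CredalNet.interaction_eq_zero (a := b) _ hbK,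
    CredalNet.interaction_eq_zero (a := c) _ hcK, add_zero]
  · intro y z hyz
    have := dependsOn_prob_agree p ({b} ∪ G.bd b) (x := y) (y := z) fun i hi => hyz i ?_
    · simp only at this
      simp only [this]
    · rintro rfl
      rcases hi with hi | hi
      exacts [hcb hi, hc hi]
  · intro y z hyz
    have h1 := dependsOn_prob_agree p (Y ∪ G.bd b) (x := y) (y := z) fun i hi => hyz i ?_
    · have h2 := dependsOn_prob_agree p (G.bd b) (x := y) (y := z) fun i hi => hyz i ?_
      · simp only at h1 h2
        simp only [h1, h2]
      · rintro rfl
        exact not_mem_bd_self _ hi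
    · rintro rfl
      rcases hi with hi | hi
      exacts [hi (Or.inl (Or.inl rfl)), not_mem_bd_self _ hi]

/-- Complete sets of the undirected graph attached to `T`. -/
def IsComplete (G : MixedGraph N) (T : Set N) (K : Finset N) : Prop :=
  (K : Set N) ⊆ T ∪ G.bdSet T ∧ (G.closureGraph T).IsClique K

/-- Any node of `K` in the component must have all the rest of `K` in its boundary. Pairs inside the
boundary of the component are joined by construction, so one node of `K` in the component suffices.
-/
theorem isComplete_of_interaction_ne_zero (h : G.IsChainGraph) (hpos : ∀ x, 0 < p x)
    (hL : G.LMCC p) {a b : N} (hb : b ∈ G.chainComp a) {K : Finset N} (hbK : b ∈ K)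
    {x : N → Bool}
    (hx : interaction (fun y => Real.log (prob p (agree (G.de a)ᶜ y))) K x ≠ 0) :
    G.IsComplete (G.chainComp a) K := by
  have key : ∀ t ∈ G.chainComp a, t ∈ K → ∀ c ∈ K, c ≠ t → c ∈ G.bd t := by
    intro t ht htK c hc hct
    by_contra hn
    exact hx (hL.interaction_eq_zero h hpos ht hct hn htK hc x)
  have hsub : ∀ i ∈ K, i ∈ G.chainComp a ∪ G.bdSet (G.chainComp a) := by
    intro i hi
    by_cases hib : i = b
    · exact Or.inl (hib ▸ hb)
    · exact bd_subset_chainComp_union hb (key b hb hbK i hi hib)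
  refine ⟨hsub, ?_⟩
  intro u hu v hv huv
  refine ⟨huv, hsub u hu, hsub v hv, ?_⟩
  rcases hsub u hu with hu' | hu'
  · rcases key u hu' hu v hv huv.symm with hd | hd
    exacts [Or.inr (Or.inl hd), Or.inr (Or.inr (Or.inl (G.und_symm _ _ hd)))]
  · rcases hsub v hv with hv' | hv'
    · rcases key v hv' hv u hu huv with hd | hd
      exacts [Or.inl hd, Or.inr (Or.inr (Or.inl hd))]
    · exact Or.inr (Or.inr (Or.inr ⟨hu', hv'⟩))

theorem exists_clique_of_isComplete {T : Set N} {K : Finset N} (hK : G.IsComplete T K) :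
    ∃ M ∈ G.closureCliques T, K ⊆ M := by
  classical
  obtain ⟨M, hKM, hM⟩ := Finite.exists_le_maximal (p := G.IsComplete T) hK
  exact ⟨M, Finset.mem_filter.2 ⟨Finset.mem_univ _, hM⟩, hKM⟩

/-- Hammersley-Clifford: the marginal of the non-descendants of a chain component is a product over
cliques, up to a factor that does not depend on the component. -/
theorem exists_cliqueFactorizes (h : G.IsChainGraph) (hpos : ∀ x, 0 < p x) (hL : G.LMCC p)
    (a : N) : ∃ φ g : (N → Bool) → ℝ, G.CliqueFactorizes (G.chainComp a) φ ∧
      DependsOn g (G.chainComp a)ᶜ ∧ ∀ x, prob p (agree (G.de a)ᶜ x) = φ x * g x := by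
  classical
  set T := G.chainComp a
  set f := fun y => Real.log (prob p (agree (G.de a)ᶜ y)) with hf
  choose! m hm hKm using fun K (hK : G.IsComplete T K) => exists_clique_of_isComplete hK
  let A : Finset (Finset N) := Finset.univ.filter fun K => G.IsComplete T K ∧ ∃ i ∈ K, i ∈ T
  let ψ : Finset N → (N → Bool) → ℝ := fun M x =>
    Real.exp (∑ K ∈ A.filter (fun K => m K = M), interaction f K x)
  let g : (N → Bool) → ℝ := fun x =>
    Real.exp (∑ K ∈ Finset.univ.filter (fun K : Finset N => ¬ ∃ i ∈ K, i ∈ T), interaction f K x)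
  refine ⟨fun x => ∏ M ∈ G.closureCliques T, ψ M x, g,
    ⟨ψ, fun _ _ => Real.exp_pos _, ?_, fun _ => rfl⟩, ?_, ?_⟩
  · intro M x y hxy
    simp only [ψ]
    congr 1
    refine Finset.sum_congr rfl fun K hK => dependsOn_interaction f K fun i hi => hxy i ?_
    simp only [A, Finset.mem_filter, Finset.mem_univ, true_and] at hK
    rw [← hK.2]
    exact hKm K hK.1.1 hi
  · intro x y hxy
    simp only [g]
    congr 1
    refine Finset.sum_congr rfl fun K hK => dependsOn_interaction f K fun i hi => hxy i ?_
    simp only [Finset.mem_filter, Finset.mem_univ, true_and] at hK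
    exact fun hiT => hK ⟨i, hi, hiT⟩
  · intro x
    simp only [ψ, g]
    rw [← Real.exp_sum, Finset.sum_fiberwise_of_maps_to, ← Real.exp_add]
    · rw [← Real.exp_log (prob_agree_pos hpos (G.de a)ᶜ x)]
      congr 1
      change f x = _
      rw [← sum_interaction f x,
        ← Finset.sum_filter_add_sum_filter_not Finset.univ (fun K : Finset N => ∃ i ∈ K, i ∈ T)]
      congr 1
      symm
      refine Finset.sum_subset ?_ ?_
      · intro K
        simp only [A, Finset.mem_filter, Finset.mem_univ, true_and]
        exact And.right
      · intro K hK hKA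
        simp only [A, Finset.mem_filter, Finset.mem_univ, true_and] at hK hKA
        by_contra hne
        obtain ⟨i, hi, hiT⟩ := hK
        exact hKA ⟨isComplete_of_interaction_ne_zero h hpos hL hiT hi hne, i, hi, hiT⟩
    · intro K hK
      simp only [A, Finset.mem_filter, Finset.mem_univ, true_and] at hK
      exact hm K hK.1

theorem CliqueFactorizes.dependsOn {T : Set N} {φ : (N → Bool) → ℝ} (h : G.CliqueFactorizes T φ) :
    DependsOn φ (T ∪ G.bdSet T) := by
  obtain ⟨ψ, -, h2, h3⟩ := h
  intro x y hxy
  rw [h3, h3]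
  refine Finset.prod_congr rfl fun K hK => h2 K x y fun i hi => hxy i ?_
  simp only [closureCliques, Finset.mem_filter] at hK
  exact hK.2.1.1 hi

/-- The conditional distribution of a chain component, given any set of non-descendants that
contains its boundary. -/
theorem exists_condProb_eq (h : G.IsChainGraph) (hpos : ∀ x, 0 < p x) (hL : G.LMCC p) (a : N) :
    ∃ φ : (N → Bool) → ℝ, G.CliqueFactorizes (G.chainComp a) φ ∧
      ∀ R, G.bdSet (G.chainComp a) ⊆ R → R ⊆ (G.de a)ᶜ \ G.chainComp a → ∀ x,
        condProb p (agree (G.chainComp a) x) (agree R x) = φ x / sumOver (G.chainComp a) φ x := by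
  obtain ⟨φ, g, hφ, hg, hS⟩ := exists_cliqueFactorizes h hpos hL a
  refine ⟨φ, hφ, fun R hR1 hR2 x => ?_⟩
  set T := G.chainComp a
  set D := (G.de a)ᶜ \ (T ∪ R) with hD
  have hT : T ⊆ (G.de a)ᶜ := by
    intro b hb hbd
    rw [h.mem_de_iff] at hbd
    exact hbd.2 (h.mem_chainComp_iff.1 hb).2
  have h1 : ∀ y, prob p (agree (T ∪ R) y) = φ y * sumOver D g y := by
    intro y
    rw [prob_agree_sum (D := D) (S := (G.de a)ᶜ) Set.disjoint_sdiff_right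
      (Set.union_sdiff_cancel (Set.union_subset hT fun i hi => (hR2 hi).1))]
    simp only [hS]
    refine sumOver_mul_left (fun x y hxy => hφ.dependsOn fun i hi => hxy i fun hiD => ?_) _ _
    exact hiD.2 (Set.union_subset_union_right T hR1 hi)
  have h2 : prob p (agree R x) = sumOver D g x * sumOver T φ x := by
    rw [prob_agree_sum (D := T) (S := T ∪ R) _ (Set.union_comm _ _)]
    · simp only [h1]
      simp only [mul_comm (φ _)]
      exact sumOver_mul_left (fun x y hxy => dependsOn_sumOver hg D fun i hi => hxy i hi.1) _ _
    · rw [Set.disjoint_left]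
      exact fun i hi => (hR2 hi).2
  have h3 := prob_agree_pos hpos R x
  rw [h2] at h3
  -- The common factor `sumOver D g x` cancels; it is nonzero because it divides a positive
  -- probability.
  rw [condProb_agree, h1, h2, mul_comm, mul_div_mul_left]
  rintro h0
  simp [h0] at h3

theorem IsChainGraph.chainComp_eq (h : G.IsChainGraph) {a b : N} (hb : b ∈ G.chainComp a) :
    G.chainComp b = G.chainComp a := by
  ext c
  rw [h.mem_chainComp_iff] at *
  rw [h.mem_chainComp_iff]
  exact ⟨fun ⟨h1, h2⟩ => ⟨hb.1.trans h1, h2.trans hb.2⟩,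
    fun ⟨h1, h2⟩ => ⟨hb.2.trans h1, h2.trans hb.1⟩⟩

theorem mem_chainComp_self (a : N) : a ∈ G.chainComp a := ReflTransGen.refl

/-- Every nonempty set of nodes has an element without descendants in the set. -/
theorem IsChainGraph.exists_terminal (h : G.IsChainGraph) {U : Set N} (hU : U.Nonempty) :
    ∃ a ∈ U, ∀ b ∈ U, b ∉ G.de a := by
  let r : N → N → Prop := fun b a => b ∈ G.de a
  have : IsTrans N r := ⟨fun x y z hxy hyz => by
    simp only [r, h.mem_de_iff] at *
    exact ⟨hyz.1.trans hxy.1, fun hn => hyz.2 (hxy.1.trans hn)⟩⟩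
  have : Std.Irrefl r := ⟨h.not_mem_de_self⟩
  exact (Finite.wellFounded_of_trans_of_irrefl r).has_min U hU

theorem reach_mem_of_lower {U : Set N} (hU : ∀ b ∈ U, ∀ c, G.step c b → c ∈ U) {a b : N}
    (hab : ReflTransGen G.step a b) (hb : b ∈ U) : a ∈ U := by
  induction hab using ReflTransGen.head_induction_on with
  | refl => exact hb
  | head h1 _ ih => exact hU _ ih _ h1

theorem chainComp_subset_of_lower {U : Set N} (hU : ∀ b ∈ U, ∀ c, G.step c b → c ∈ U) {a : N}
    (ha : a ∈ U) : G.chainComp a ⊆ U := fun _ hb =>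
  reach_mem_of_lower hU (reach_of_und (reach_symm_of_und hb)) ha

open Classical in
/-- The marginal of a set closed under boundaries is the product of the conditional probabilities
of the chain components in it. -/
theorem prob_agree_eq_prod (h : G.IsChainGraph) (hpos : ∀ x, 0 < p x)
    (hsum : ∑ x, p x = 1) (hL : G.LMCC p) (U : Set N)
    (hU : ∀ b ∈ U, ∀ c, G.step c b → c ∈ U) (x : N → Bool) :
    prob p (agree U x) = ∏ T ∈ G.chainComps.filter (· ⊆ U),
      condProb p (agree T x) (agree (G.bdSet T) x) := by
  induction hn : U.ncard using Nat.strong_induction_on generalizing U with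
  | _ n ih =>
  rcases U.eq_empty_or_nonempty with rfl | hne
  · rw [Finset.prod_eq_one]
    · simpa [prob, agree] using hsum
    · intro T hT
      obtain ⟨a, rfl⟩ : ∃ a, G.chainComp a = T := by simpa [chainComps] using (Finset.mem_filter.1 hT).1
      exact absurd ((Finset.mem_filter.1 hT).2 (mem_chainComp_self a)) (by simp)
  · obtain ⟨a, haU, hmax⟩ := h.exists_terminal hne
    set T := G.chainComp a with hT
    have hTU : T ⊆ U := chainComp_subset_of_lower hU haU
    have haT : a ∈ T := mem_chainComp_self a
    -- An arrow from `T` to `b ∈ U \ T` would make `b` a descendant of `a` in `U`, against the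
    -- choice of `a`.
    have hlow : ∀ b ∈ U \ T, ∀ c, G.step c b → c ∈ U \ T := by
      rintro b ⟨hbU, hbT⟩ c hcb
      refine ⟨hU b hbU c hcb, fun hcT => ?_⟩
      have h1 := (h.mem_chainComp_iff.1 hcT).1.tail hcb
      refine hbT (h.mem_chainComp_iff.2 ⟨h1, ?_⟩)
      by_contra h2
      exact hmax b hbU (h.mem_de_iff.2 ⟨h1, h2⟩)
    have hbdU : G.bdSet T ⊆ U \ T := by
      rintro b ⟨hb, hbT⟩
      obtain ⟨t, ht, hbt⟩ := Set.mem_iUnion₂.1 hb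
      exact ⟨hU t (hTU ht) b hbt, hbT⟩
    have hUS : U \ T ⊆ (G.de a)ᶜ \ T := fun b hb => ⟨hmax b hb.1, hb.2⟩
    obtain ⟨φ, -, hφ⟩ := exists_condProb_eq h hpos hL a
    -- Conditioning on `U \ T` and on the boundary of `T` gives the same normalized function.
    have h1 := (hφ (U \ T) hbdU hUS x).trans
      (hφ (G.bdSet T) subset_rfl (hbdU.trans hUS) x).symm
    have hfil : G.chainComps.filter (· ⊆ U) = insert T (G.chainComps.filter (· ⊆ U \ T)) := by
      ext T'
      simp only [Finset.mem_filter, Finset.mem_insert]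
      constructor
      · rintro ⟨h1, h2⟩
        obtain ⟨b, rfl⟩ : ∃ b, G.chainComp b = T' := by simpa [chainComps] using h1
        by_cases hbT : b ∈ T
        · exact Or.inl (h.chainComp_eq hbT)
        · refine Or.inr ⟨h1, fun c hc => ⟨h2 hc, fun hcT => hbT ?_⟩⟩
          rw [hT, ← h.chainComp_eq hcT, h.chainComp_eq hc]
          exact mem_chainComp_self b
      · rintro (rfl | ⟨h1, h2⟩)
        · exact ⟨by simp [chainComps, hT], hTU⟩
        · exact ⟨h1, h2.trans Set.sdiff_subset⟩
    rw [hfil, Finset.prod_insert, ← ih _ _ (U \ T) hlow rfl, ← h1, condProb_agree,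
      Set.union_sdiff_cancel hTU, div_mul_cancel₀ _ (prob_agree_pos hpos _ _).ne']
    · rw [← hn]
      exact Set.ncard_lt_ncard ⟨Set.sdiff_subset, fun hs => (hs haU).2 haT⟩
    · intro hmem
      exact ((Finset.mem_filter.1 hmem).2 haT).2 haT

theorem LMCC.chainFactorizes (h : G.IsChainGraph) (hpos : ∀ x, 0 < p x) (hsum : ∑ x, p x = 1)
    (hL : G.LMCC p) : G.ChainFactorizes p := by
  classical
  constructor
  · intro x
    have h1 := prob_agree_eq_prod h hpos hsum hL Set.univ (fun _ _ _ _ => trivial) x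
    have h2 : agree Set.univ x = {x} := by
      ext ω
      simp [agree, funext_iff]
    have h3 : prob p {x} = p x := by
      simp [prob, Finset.filter_eq']
    rw [h2, h3] at h1
    rw [h1]
    refine Finset.prod_congr ?_ fun _ _ => rfl
    simp
  · intro T hT
    obtain ⟨a, rfl⟩ : ∃ a, G.chainComp a = T := by simpa [chainComps] using hT
    obtain ⟨φ, hφ, hc⟩ := exists_condProb_eq h hpos hL a
    refine ⟨φ, hφ, hc _ subset_rfl ?_⟩
    rintro b ⟨hb, hbT⟩
    refine ⟨fun hbd => ?_, hbT⟩
    obtain ⟨t, ht, hbt⟩ := Set.mem_iUnion₂.1 hb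
    rw [← h.de_eq_of_mem_chainComp ht] at hbd
    exact h.not_mem_de_of_mem_bd hbt hbd

/-- A node is independent, given its boundary, of any set of nodes that together with it and its
boundary is closed under boundaries and contains no child of the node. -/
theorem LMCC.condIndep_of_lower (h : G.IsChainGraph) (hpos : ∀ x, 0 < p x) (hsum : ∑ x, p x = 1)
    (hL : G.LMCC p) {A : N} {Y : Set N} (hAY : A ∉ Y) (hYbd : Disjoint Y (G.bd A))
    (hlow : ∀ b ∈ {A} ∪ Y ∪ G.bd A, ∀ c, G.step c b → c ∈ {A} ∪ Y ∪ G.bd A)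
    (hchild : ∀ b ∈ {A} ∪ Y ∪ G.bd A, ¬ G.dir A b) : CondIndep p {A} Y (G.bd A) := by
  classical
  set W := {A} ∪ Y ∪ G.bd A with hW
  set T := G.chainComp A with hT
  have hAW : A ∈ W := Or.inl (Or.inl rfl)
  have hTW : T ⊆ W := chainComp_subset_of_lower hlow hAW
  obtain ⟨φ, ⟨ψ, hψ1, hψ2, hψ3⟩, hc⟩ := exists_condProb_eq h hpos hL A
  have hcT := hc _ subset_rfl (by
    rintro b ⟨hb, hbT⟩
    refine ⟨fun hbd => ?_, hbT⟩
    obtain ⟨t, ht, hbt⟩ := Set.mem_iUnion₂.1 hb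
    rw [← h.de_eq_of_mem_chainComp ht] at hbd
    exact h.not_mem_de_of_mem_bd hbt hbd)
  set C := G.closureCliques T
  set Q := (G.chainComps.filter (· ⊆ W)).erase T
  refine condIndep_of_factorization hpos (Set.disjoint_singleton_left.2 hAY)
    (Set.disjoint_singleton_left.2 (not_mem_bd_self A)) hYbd
    -- All dependence on `A` is put into `α`. The normalizer in `β` is summed over the values on `T
    -- ∋ A`, so it is free of `A`.
    (α := fun x => ∏ K ∈ C.filter (A ∈ ·), ψ K x)
    (β := fun x => ((∏ K ∈ C.filter (A ∉ ·), ψ K x) * (sumOver T φ x)⁻¹) *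
      ∏ T' ∈ Q, condProb p (agree T' x) (agree (G.bdSet T') x)) ?_ ?_ ?_
  · refine dependsOn_prod fun K hK => ?_
    simp only [C, closureCliques, Finset.mem_filter, Finset.mem_univ, true_and] at hK
    obtain ⟨hKmax, hAK⟩ := hK
    intro x y hxy
    refine hψ2 K x y fun i hi => hxy i fun hiY => ?_
    have hiA : i ≠ A := by
      rintro rfl
      exact hAY hiY
    -- A node sharing a clique with `A ∈ T` is adjacent to it and, as `T` and its boundary contain
    -- no child of `A`, lies in the boundary of `A`, hence not in `Y`.
    obtain ⟨-, -, hiT, hadj⟩ := hKmax.1.2 hAK hi hiA.symm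
    have hAT : A ∉ G.bdSet T := fun hm => hm.2 (mem_chainComp_self A)
    refine Set.disjoint_left.1 hYbd hiY ?_
    rcases hadj with hd | hd | hd | hd
    · exact absurd hd (h.not_dir_chainComp (mem_chainComp_self A) hiT)
    · exact Or.inl hd
    · exact Or.inr (G.und_symm _ _ hd)
    · exact absurd hd.1 hAT
  · intro x y hxy
    have h1 : ∏ K ∈ C.filter (A ∉ ·), ψ K x = ∏ K ∈ C.filter (A ∉ ·), ψ K y := by
      refine Finset.prod_congr rfl fun K hK => hψ2 K x y fun i hi => hxy i ?_
      rintro rfl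
      exact (Finset.mem_filter.1 hK).2 hi
    have h2 : sumOver T φ x = sumOver T φ y := by
      refine dependsOn_sumOver (S := Set.univ) (fun x y hxy => ?_) T fun i hi => hxy i ?_
      · rw [funext fun i => hxy i trivial]
      · rintro rfl
        exact hi.2 (mem_chainComp_self i)
    have h3 : ∀ T' ∈ Q, condProb p (agree T' x) (agree (G.bdSet T') x) =
        condProb p (agree T' y) (agree (G.bdSet T') y) := by
      intro T' hT'
      simp only [Q, Finset.mem_erase, Finset.mem_filter] at hT'
      obtain ⟨hne, hmem, hsub⟩ := hT'
      obtain ⟨b, rfl⟩ : ∃ b, G.chainComp b = T' := by simpa [chainComps] using hmem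
      have hA1 : A ∉ G.chainComp b := fun hA => hne (h.chainComp_eq hA).symm
      have hA2 : A ∉ G.bdSet (G.chainComp b) := by
        rintro ⟨hA, -⟩
        obtain ⟨t, ht, hAt⟩ := Set.mem_iUnion₂.1 hA
        rcases hAt with hAt | hAt
        · exact hchild t (hsub ht) hAt
        · exact hA1 (ReflTransGen.tail ht (G.und_symm _ _ hAt))
      rw [agree_congr (S := G.chainComp b) (x := x) (y := y) fun i hi => hxy i ?_,
        agree_congr (S := G.bdSet (G.chainComp b)) (x := x) (y := y) fun i hi => hxy i ?_]
      · rintro rfl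
        exact hA2 hi
      · rintro rfl
        exact hA1 hi
    simp only [h1, h2, Finset.prod_congr rfl h3]
  · intro x
    have hTm : T ∈ G.chainComps.filter (· ⊆ W) := by
      simp only [Finset.mem_filter]
      exact ⟨by simp [chainComps, hT], hTW⟩
    rw [prob_agree_eq_prod h hpos hsum hL W hlow x, ← Finset.mul_prod_erase _ _ hTm, hcT, hψ3,
      ← Finset.prod_filter_mul_prod_filter_not C (A ∈ ·)]
    simp only [div_eq_mul_inv]
    ring

end MixedGraph

open Relation

/-! ### Formulas, dependency graphs and lcn-parents -/

namespace Formula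

variable {N : Type*}

theorem Equivalent.atoms_eq {φ ψ : Formula N} (h : φ.Equivalent ψ) : φ.atoms = ψ.atoms := by
  ext A
  simp only [atoms, Set.mem_ofPred_eq, h _]

theorem atoms_var (A : N) : (var A).atoms = {A} := by
  classical
  ext B
  simp only [atoms, eval, Set.mem_ofPred_eq, Set.mem_singleton_iff]
  constructor
  · rintro ⟨v, w, h1, h2⟩
    by_contra hne
    exact h2 (h1 A (Ne.symm hne))
  · rintro rfl
    exact ⟨fun _ => true, fun i => decide (i ≠ B), fun i hi => by simp [hi], by simp⟩

theorem atoms_of_equivalent_var {φ : Formula N} {A : N} (h : φ.Equivalent (var A)) :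
    φ.atoms = {A} := h.atoms_eq.trans (atoms_var A)

theorem atoms_of_equivalent_top {φ : Formula N} (h : φ.Equivalent top) : φ.atoms = ∅ := by
  rw [h.atoms_eq]
  ext B
  simp [atoms, eval]

end Formula

namespace LCN

variable {N : Type*} (L : LCN N)

theorem step_structureGraph {A B : N} :
    L.structureGraph.step A B ↔ L.undEdge A B ∨ L.dirEdge A B := by
  simp only [MixedGraph.step, structureGraph]
  tauto

section

variable {F : Type*} (hd bd : Constraint N → F)

/-- Requirements on the names of formula-nodes: they determine the propositions in a formula, and
are shared between the two roles only as in `RolesSeparated`. -/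
structure NamesCompatible : Prop where
  conditioning : ∀ c c', bd c = bd c' → c.conditioning.atoms = c'.conditioning.atoms
  conditioned : ∀ c c', hd c = hd c' → c.conditioned.atoms = c'.conditioned.atoms
  roles : ∀ c ∈ L.constraints, ∀ c' ∈ L.constraints, ¬ c'.Unconditional →
    ¬ c'.conditioning.IsSingle → hd c = bd c' →
    c ∈ L.TU ∧ c.Unconditional ∧ c.conditioned.atoms = c'.conditioning.atoms

variable {hd bd}

/-- How a proposition can reach a formula-node through formula-nodes. -/
def FormulaReach (hd bd : Constraint N → F) (B : N) (f : F) : Prop :=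
  (∃ c ∈ L.constraints, ¬ c.Unconditional ∧ ¬ c.conditioning.IsSingle ∧ bd c = f ∧
    B ∈ c.conditioning.atoms) ∨
  (∃ c ∈ L.TU, hd c = f ∧ B ∈ c.conditioned.atoms) ∨
  (∃ c ∈ L.constraints, hd c = f ∧ B ∈ c.conditioning.atoms)

theorem formulaReach_or_step_of_inl {B : N} {u : N ⊕ F} (h : L.DepEdge hd bd (Sum.inl B) u) :
    (∃ f, u = Sum.inr f ∧ L.FormulaReach hd bd B f) ∨
      ∃ A, u = Sum.inl A ∧ L.structureGraph.step B A := by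
  obtain ⟨h, hne⟩ := h
  rcases h with ⟨c, _, _, hc, hun, hu, hv⟩ | ⟨c, _, _, hc, hun, hA, hu⟩ | ⟨c, A, _, hc, hA, hv⟩ |
    ⟨c, _, _, hc, hA, hv⟩
  · cases hu with
    | proposition _ heq =>
      have hB : B ∈ c.conditioning.atoms := by simp [Formula.atoms_of_equivalent_var heq]
      cases hv with
      | proposition A hA =>
        refine Or.inr ⟨A, rfl, L.step_structureGraph.2 (Or.inr ⟨?_, c, hc, hB, ?_⟩)⟩
        · rintro rfl
          exact hne rfl
        · simp [Formula.atoms_of_equivalent_var hA]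
      | formula hs => exact Or.inl ⟨_, rfl, Or.inr (Or.inr ⟨c, hc, rfl, hB⟩)⟩
  · cases hu with
    | proposition A heq =>
      rw [Formula.atoms_of_equivalent_var heq] at hA
      exact absurd (congrArg Sum.inl hA) hne
    | formula hs => exact Or.inl ⟨_, rfl, Or.inl ⟨c, hc, hun, hs, rfl, hA⟩⟩
  · cases hv with
    | proposition _ heq =>
      rw [Formula.atoms_of_equivalent_var heq] at hA
      exact absurd (congrArg Sum.inl (Eq.symm hA)) hne
  · cases hv with
    | proposition A heq =>
      rw [Formula.atoms_of_equivalent_var heq] at hA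
      exact absurd (congrArg Sum.inl hA) hne
    | formula hs => exact Or.inl ⟨_, rfl, Or.inr (Or.inl ⟨c, hc, rfl, hA⟩)⟩

/-- This is the inductive step of the invariant, and the place where the restriction on shared roles
is needed. -/
theorem formulaReach_or_step_of_inr (H : L.NamesCompatible hd bd) {B : N} {f : F}
    (hf : L.FormulaReach hd bd B f) {u : N ⊕ F} (h : L.DepEdge hd bd (Sum.inr f) u) :
    (∃ f', u = Sum.inr f' ∧ L.FormulaReach hd bd B f') ∨
      ∃ A, u = Sum.inl A ∧ (A = B ∨ L.structureGraph.step B A) := by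
  obtain ⟨h, -⟩ := h
  rcases h with ⟨c, _, _, hc, hun, hu, hv⟩ | _ | ⟨c, A, _, hc, hA, hv⟩ | _
  · cases hu with
    | formula hs =>
      have hB : B ∈ c.conditioning.atoms := by
        rcases hf with ⟨c', -, -, -, heq, hB⟩ | ⟨c', hc', heq, hB⟩ | ⟨c', hc', heq, hB⟩
        · rwa [← H.conditioning _ _ heq]
        · rwa [← (H.roles c' (Or.inl hc') c hc hun hs heq).2.2]
        -- A node in both roles belongs to an unconditional `c'`, whose conditioning formula has no
        -- propositions.
        · have := (H.roles c' hc' c hc hun hs heq).2.1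
          rw [Formula.atoms_of_equivalent_top this] at hB
          exact absurd hB (by simp)
      cases hv with
      | proposition A hA =>
        refine Or.inr ⟨A, rfl, ?_⟩
        by_cases hAB : A = B
        · exact Or.inl hAB
        · refine Or.inr (L.step_structureGraph.2 (Or.inr ⟨Ne.symm hAB, c, hc, hB, ?_⟩))
          simp [Formula.atoms_of_equivalent_var hA]
      | formula hs => exact Or.inl ⟨_, rfl, Or.inr (Or.inr ⟨c, hc, rfl, hB⟩)⟩
  · cases hv with
    | formula hs =>
      refine Or.inr ⟨A, rfl, ?_⟩
      by_cases hAB : A = B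
      · exact Or.inl hAB
      refine Or.inr (L.step_structureGraph.2 ?_)
      rcases hf with ⟨c', hc', hun, hs', heq, hB⟩ | ⟨c', hc', heq, hB⟩ | ⟨c', hc', heq, hB⟩
      -- The node is shared: `c` then lies in `TU` and its conditioned formula contains both `A` and
      -- `B`, which gives an undirected edge.
      · obtain ⟨h1, -, h3⟩ := H.roles c hc c' hc' hun hs' heq.symm
        exact Or.inl ⟨Ne.symm hAB, c, h1, h3 ▸ hB, hA⟩
      · exact Or.inl ⟨Ne.symm hAB, c', hc', hB, H.conditioned _ _ heq ▸ hA⟩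
      · exact Or.inr ⟨Ne.symm hAB, c', hc', hB, H.conditioned _ _ heq ▸ hA⟩

theorem step_of_inr_walk (H : L.NamesCompatible hd bd) {A B : N} (hAB : A ≠ B) :
    ∀ (l : List (N ⊕ F)) (f : F), L.FormulaReach hd bd B f →
      List.IsChain (L.DepEdge hd bd) (Sum.inr f :: (l ++ [Sum.inl A])) →
      (∀ u ∈ l, ∃ f : F, u = Sum.inr f) → L.structureGraph.step B A := by
  intro l
  induction l with
  | nil =>
    intro f hf h _
    rw [List.nil_append, List.isChain_pair] at h
    rcases L.formulaReach_or_step_of_inr H hf h with ⟨f', h', -⟩ | ⟨A', h', h2⟩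
    · cases h'
    · cases h'
      exact h2.resolve_left hAB
  | cons u t ih =>
    intro f hf h hl
    rw [List.cons_append, List.isChain_cons_cons] at h
    obtain ⟨f', rfl⟩ := hl u (by simp)
    rcases L.formulaReach_or_step_of_inr H hf h.1 with ⟨f'', h', h2⟩ | ⟨A', h', -⟩
    · cases h'
      exact ih f' h2 h.2 fun u hu => hl u (by simp [hu])
    · cases h'

theorem step_of_mem_lcnPa (H : L.NamesCompatible hd bd) {A B : N} (h : B ∈ L.lcnPa hd bd A) :
    L.structureGraph.step B A := by
  obtain ⟨hBA, l, ⟨hl, -⟩, hinr⟩ := h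
  cases l with
  | nil =>
    rw [List.nil_append, List.isChain_pair] at hl
    rcases L.formulaReach_or_step_of_inl hl with ⟨f', h', -⟩ | ⟨A', h', h2⟩
    · cases h'
    · cases h'
      exact h2
  | cons u t =>
    rw [List.cons_append, List.isChain_cons_cons] at hl
    obtain ⟨f, rfl⟩ := hinr u (by simp)
    rcases L.formulaReach_or_step_of_inl hl.1 with ⟨f', h', h2⟩ | ⟨A', h', -⟩
    · cases h'
      exact L.step_of_inr_walk H hBA.symm t f h2 hl.2 fun u hu => hinr u (by simp [hu])
    · cases h'

theorem mem_lcnPa_of_isChain {A B : N} (hBA : B ≠ A) {l : List (N ⊕ F)}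
    (hl : List.IsChain (L.DepEdge hd bd) (Sum.inl B :: (l ++ [Sum.inl A])))
    (hinr : ∀ u ∈ l, ∃ f : F, u = Sum.inr f) : B ∈ L.lcnPa hd bd A := by
  obtain ⟨l', hsub, hp⟩ := exists_isPath_of_isChain l _ (fun h => hBA (Sum.inl_injective h)) hl
  exact ⟨hBA, l', hp, fun u hu => hinr u (hsub hu)⟩

theorem isNodeOf_cases (φ : Formula N) (f : F) :
    (∃ A, φ.atoms = {A} ∧ IsNodeOf φ f (Sum.inl A)) ∨ IsNodeOf φ f (Sum.inr f) := by
  by_cases h : φ.IsSingle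
  · obtain ⟨A, hA⟩ := h
    exact Or.inl ⟨A, Formula.atoms_of_equivalent_var hA, .proposition A hA⟩
  · exact Or.inr (.formula h)

theorem mem_lcnPa_of_step {A B : N} (h : L.structureGraph.step B A) : B ∈ L.lcnPa hd bd A := by
  rcases L.step_structureGraph.1 h with ⟨hne, c, hc, hB, hA⟩ | ⟨hne, c, hc, hB, hA⟩
  · rcases isNodeOf_cases c.conditioned (hd c) with ⟨C, hC, -⟩ | hn
    · rw [hC] at hA hB
      exact absurd (hB.trans hA.symm) hne
    · refine L.mem_lcnPa_of_isChain hne (l := [Sum.inr (hd c)]) ?_ (by simp)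
      simp only [List.cons_append, List.nil_append, List.isChain_cons_cons, List.isChain_singleton,
        and_true]
      exact ⟨⟨.intoConditioned c B _ hc hB hn, by simp⟩,
        ⟨.outOfConditioned c A _ (Or.inl hc) hA hn, by simp⟩⟩
  · have hun : ¬ c.Unconditional := by
      intro hu
      rw [Formula.atoms_of_equivalent_top hu] at hB
      exact hB
    rcases isNodeOf_cases c.conditioned (hd c) with ⟨C, hC, hn⟩ | hn
    · obtain rfl : A = C := by simpa [hC] using hA
      rcases isNodeOf_cases c.conditioning (bd c) with ⟨D, hD, hm⟩ | hm
      · obtain rfl : B = D := by simpa [hD] using hB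
        refine L.mem_lcnPa_of_isChain hne (l := []) ?_ (by simp)
        rw [List.nil_append, List.isChain_pair]
        exact ⟨.link c _ _ hc hun hm hn, by simpa using hne⟩
      · refine L.mem_lcnPa_of_isChain hne (l := [Sum.inr (bd c)]) ?_ (by simp)
        simp only [List.cons_append, List.nil_append, List.isChain_cons_cons,
          List.isChain_singleton, and_true]
        exact ⟨⟨.intoConditioning c B _ hc hun hB hm, by simp⟩,
          ⟨.link c _ _ hc hun hm hn, by simp⟩⟩
    · have hout : L.DepEdge hd bd (Sum.inr (hd c)) (Sum.inl A) :=
        ⟨.outOfConditioned c A _ hc hA hn, by simp⟩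
      rcases isNodeOf_cases c.conditioning (bd c) with ⟨D, hD, hm⟩ | hm
      · obtain rfl : B = D := by simpa [hD] using hB
        refine L.mem_lcnPa_of_isChain hne (l := [Sum.inr (hd c)]) ?_ (by simp)
        simp only [List.cons_append, List.nil_append, List.isChain_cons_cons,
          List.isChain_singleton, and_true]
        exact ⟨⟨.link c _ _ hc hun hm hn, by simp⟩, hout⟩
      · have hin : L.DepEdge hd bd (Sum.inl B) (Sum.inr (bd c)) :=
          ⟨.intoConditioning c B _ hc hun hB hm, by simp⟩
        -- If both formulas share a node, the linking edge would be a loop, which the graph lacks;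
        -- the walk then passes through that node once.
        by_cases heq : bd c = hd c
        · refine L.mem_lcnPa_of_isChain hne (l := [Sum.inr (hd c)]) ?_ (by simp)
          simp only [List.cons_append, List.nil_append, List.isChain_cons_cons,
            List.isChain_singleton, and_true]
          exact ⟨heq ▸ hin, hout⟩
        · refine L.mem_lcnPa_of_isChain hne (l := [Sum.inr (bd c), Sum.inr (hd c)]) ?_ (by simp)
          simp only [List.cons_append, List.nil_append, List.isChain_cons_cons,
            List.isChain_singleton, and_true]
          exact ⟨hin, ⟨.link c _ _ hc hun hm hn, by simpa using heq⟩, hout⟩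

/-- The lcn-parents are the nodes of the boundary in the structure. -/
theorem lcnPa_eq_bd (H : L.NamesCompatible hd bd) (A : N) :
    L.lcnPa hd bd A = L.structureGraph.bd A := by
  ext B
  exact ⟨L.step_of_mem_lcnPa H, L.mem_lcnPa_of_step⟩

/-! ### lcn-descendants and the equivalence of the Markov conditions -/

theorem mem_lcnDe_of_step_self (H : L.NamesCompatible hd bd) {A B : N}
    (h : L.structureGraph.step A B) : B ∈ L.lcnDe hd bd A := by
  have h' : A ∈ L.lcnPa hd bd B := by rwa [L.lcnPa_eq_bd H]
  obtain ⟨-, l, hl, hinr⟩ := h'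
  refine ⟨l, hl, fun C _ hC => ?_⟩
  obtain ⟨f, hf⟩ := hinr _ hC
  cases hf

/-- The path to `E` is prolonged through formula-nodes; its only new intermediate proposition is
`E`, hence the requirement that `E` avoid the boundary. -/
theorem mem_lcnDe_of_step (H : L.NamesCompatible hd bd) {A E B : N} (hE : E ∈ L.lcnDe hd bd A)
    (hEbd : E ∉ L.structureGraph.bd A) (hAB : A ≠ B) (h : L.structureGraph.step E B) :
    B ∈ L.lcnDe hd bd A := by
  have h' : E ∈ L.lcnPa hd bd B := by rwa [L.lcnPa_eq_bd H]
  obtain ⟨-, l, ⟨hl, -⟩, hinr⟩ := h'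
  obtain ⟨m, ⟨hm, -⟩, hav⟩ := hE
  have hchain : List.IsChain (L.DepEdge hd bd)
      (Sum.inl A :: ((m ++ Sum.inl E :: l) ++ [Sum.inl B])) := by
    have := (List.isChain_cons_split (R := L.DepEdge hd bd) (a := Sum.inl A) (l₁ := m)
      (c := Sum.inl E) (l₂ := l ++ [Sum.inl B])).2 ⟨hm, hl⟩
    simpa using this
  obtain ⟨l', hsub, hp⟩ :=
    exists_isPath_of_isChain _ _ (fun h => hAB (Sum.inl_injective h)) hchain
  refine ⟨l', hp, fun C hC hCl => ?_⟩
  rcases List.mem_append.1 (hsub hCl) with h1 | h1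
  · exact hav C hC h1
  · rcases List.mem_cons.1 h1 with h1 | h1
    · cases h1
      rw [L.lcnPa_eq_bd H] at hC
      exact hEbd hC
    · obtain ⟨f, hf⟩ := hinr _ h1
      cases hf

/-- Every node on a walk from `A` that avoids the boundary of `A` is, up to a walk through
formula-nodes, `A` or a descendant of `A`, or lies in the boundary. -/
theorem walk_invariant (H : L.NamesCompatible hd bd) (hG : L.structureGraph.IsChainGraph) {A : N}
    (l : List (N ⊕ F)) : ∀ v : N ⊕ F,
    List.IsChain (L.DepEdge hd bd) (Sum.inl A :: (l ++ [v])) →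
    (∀ C ∈ L.structureGraph.bd A, Sum.inl C ∉ l) →
    (∃ B, v = Sum.inl B ∧
      (B = A ∨ B ∈ L.structureGraph.bd A ∨ B ∈ L.structureGraph.de A)) ∨
    ∃ f, v = Sum.inr f ∧ ∃ C m, (C = A ∨ C ∈ L.structureGraph.de A) ∧
      List.IsChain (L.DepEdge hd bd) (Sum.inl C :: (m ++ [v])) ∧
      ∀ u ∈ m, ∃ f : F, u = Sum.inr f := by
  -- A step from `A` goes to a child or to a neighbor, and a step from a descendant stays among the
  -- descendants.
  have hstep : ∀ C B : N, (C = A ∨ C ∈ L.structureGraph.de A) → L.structureGraph.step C B →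
      B ∈ L.structureGraph.bd A ∨ B ∈ L.structureGraph.de A := by
    rintro C B (rfl | hC) hCB
    · rcases hCB with h | h
      · exact Or.inr (hG.mem_de_iff.2 ⟨.single (Or.inl h), hG.not_reach_of_dir h⟩)
      · exact Or.inl (Or.inr (L.structureGraph.und_symm _ _ h))
    · rw [hG.mem_de_iff] at hC
      exact Or.inr (hG.mem_de_iff.2 ⟨hC.1.tail hCB, fun hn => hC.2 (.head hCB hn)⟩)
  have hfin : ∀ (C : N) (m : List (N ⊕ F)) (v : N ⊕ F), (C = A ∨ C ∈ L.structureGraph.de A) →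
      List.IsChain (L.DepEdge hd bd) (Sum.inl C :: (m ++ [v])) →
      (∀ u ∈ m, ∃ f : F, u = Sum.inr f) →
      (∃ B, v = Sum.inl B ∧
        (B = A ∨ B ∈ L.structureGraph.bd A ∨ B ∈ L.structureGraph.de A)) ∨
      ∃ f, v = Sum.inr f ∧ ∃ C m, (C = A ∨ C ∈ L.structureGraph.de A) ∧
        List.IsChain (L.DepEdge hd bd) (Sum.inl C :: (m ++ [v])) ∧
        ∀ u ∈ m, ∃ f : F, u = Sum.inr f := by
    intro C m v hC hm hinr
    rcases v with B | f
    · refine Or.inl ⟨B, rfl, ?_⟩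
      by_cases hCB : C = B
      · subst hCB
        tauto
      · exact Or.inr (hstep C B hC (L.step_of_mem_lcnPa H (L.mem_lcnPa_of_isChain hCB hm hinr)))
    · exact Or.inr ⟨f, rfl, C, m, hC, hm, hinr⟩
  induction l using List.reverseRecOn with
  | nil =>
    intro v h _
    exact hfin A [] v (Or.inl rfl) h (by simp)
  | append_singleton t u ih =>
    intro v h hav
    rw [List.append_assoc, List.singleton_append, List.isChain_cons_split, List.isChain_pair] at h
    rcases ih u h.1 fun C hC hCt => hav C hC (by simp [hCt]) with
      ⟨B, rfl, hB⟩ | ⟨f, rfl, C, m, hC, hm, hinr⟩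
    · have hB' : B = A ∨ B ∈ L.structureGraph.de A := by
        have : B ∉ L.structureGraph.bd A := fun hb => hav B hb (by simp)
        tauto
      exact hfin B [] v hB' (by simpa using h.2) (by simp)
    · refine hfin C (m ++ [Sum.inr f]) v hC ?_ ?_
      · rw [List.append_assoc, List.singleton_append, List.isChain_cons_split, List.isChain_pair]
        exact ⟨hm, h.2⟩
      · intro u hu
        rcases List.mem_append.1 hu with hu | hu
        · exact hinr u hu
        · exact ⟨f, by simpa using hu⟩

theorem lcnDe_subset (H : L.NamesCompatible hd bd) (hG : L.structureGraph.IsChainGraph) (A : N) :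
    L.lcnDe hd bd A ⊆ {A} ∪ L.structureGraph.de A ∪ L.structureGraph.bd A := by
  rintro B ⟨l, ⟨hl, -⟩, hav⟩
  rw [L.lcnPa_eq_bd H] at hav
  rcases L.walk_invariant H hG l _ hl hav with ⟨B', h, h'⟩ | ⟨f, h, -⟩
  · cases h
    rcases h' with h' | h' | h'
    exacts [Or.inl (Or.inl h'), Or.inr h', Or.inl (Or.inr h')]
  · cases h

theorem lmcOfNames_iff [Fintype N] [DecidableEq N] (H : L.NamesCompatible hd bd)
    (hG : L.structureGraph.IsChainGraph) {p : (N → Bool) → ℝ} (hpos : ∀ x, 0 < p x)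
    (hsum : ∑ x, p x = 1) : L.LMCOfNames hd bd p ↔ L.structureGraph.LMCC p := by
  constructor
  · intro h A
    have hA := h A
    rw [L.lcnPa_eq_bd H] at hA
    refine hA.mono hpos (by simp) (by simpa using MixedGraph.not_mem_bd_self A) ?_ ?_
    · rw [Set.disjoint_left]
      exact fun i hi hi' => hi (Or.inr hi')
    · refine Set.compl_subset_compl.2 (Set.union_subset (Set.union_subset ?_ ?_) ?_)
      · exact Set.subset_union_left.trans Set.subset_union_left
      · exact L.lcnDe_subset H hG A
      · exact Set.subset_union_right
  · intro h A
    rw [L.lcnPa_eq_bd H]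
    -- The closed set consists of all nodes except the lcn-descendants that are neither `A` nor in
    -- its boundary.
    have hmem : ∀ b, b ∈ {A} ∪ ({A} ∪ L.lcnDe hd bd A ∪ L.structureGraph.bd A)ᶜ ∪
        L.structureGraph.bd A ↔
        ¬ (b ∈ L.lcnDe hd bd A ∧ b ≠ A ∧ b ∉ L.structureGraph.bd A) := by
      intro b
      simp only [Set.mem_union, Set.mem_compl_iff, Set.mem_singleton_iff]
      grind
    refine h.condIndep_of_lower hG hpos hsum (by simp) ?_ ?_ ?_
    · rw [Set.disjoint_left]
      exact fun i hi hi' => hi (Or.inr hi')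
    · intro b hb c hcb
      rw [hmem] at hb ⊢
      rintro ⟨hc, hcA, hcbd⟩
      have hbA : A ≠ b := by
        rintro rfl
        exact hcbd hcb
      -- If an excluded `c` precedes `b`, then `b` is an lcn-descendant too. It is not in the
      -- boundary, since then the descendant `c` would reach `A` through `b`.
      refine hb ⟨L.mem_lcnDe_of_step H hc hcbd hbA hcb, hbA.symm, fun hbb => ?_⟩
      have hcd : c ∈ L.structureGraph.de A := by
        rcases L.lcnDe_subset H hG A hc with (h1 | h1) | h1
        exacts [absurd h1 hcA, h1, absurd h1 hcbd]
      rw [hG.mem_de_iff] at hcd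
      exact hcd.2 (.head hcb (.single hbb))
    · intro b hb hdir
      rw [hmem] at hb
      refine hb ⟨L.mem_lcnDe_of_step_self H (Or.inl hdir), ?_, fun hbb => ?_⟩
      · rintro rfl
        exact L.structureGraph.dir_irrefl _ hdir
      · exact hG.not_reach_of_dir hdir (.single hbb)

end

theorem namesCompatible_separate :
    L.NamesCompatible (F := Constraint N × Bool) (fun c => (c, true)) (fun c => (c, false)) where
  conditioning c c' h := by
    cases h
    rfl
  conditioned c c' h := by
    cases h
    rfl
  roles c _ c' _ _ _ h := by simp at h

theorem namesCompatible_shared (h : L.RolesSeparated) :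
    L.NamesCompatible (F := (N → Bool) → Bool) (fun c => c.conditioned.eval)
      (fun c => c.conditioning.eval) where
  conditioning c c' heq := Formula.Equivalent.atoms_eq fun v => congrFun heq v
  conditioned c c' heq := Formula.Equivalent.atoms_eq fun v => congrFun heq v
  roles c hc c' hc' hun hs heq := by
    have he : c.conditioned.Equivalent c'.conditioning := fun v => congrFun heq v
    obtain ⟨h1, h2⟩ := h c' hc' c hc hun hs he
    exact ⟨h1, h2, he.atoms_eq⟩

end LCN

end CredalNet

theorem mainTheorem1 {N : Type*} [Fintype N] [DecidableEq N] (L : CredalNet.LCN N)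
    (hchain : L.structureGraph.IsChainGraph)
    (p : (N → Bool) → ℝ) (hp : p ∈ stdSimplex ℝ (N → Bool)) (hpos : ∀ x, 0 < p x) :
    (L.LMCSeparate p ↔ L.structureGraph.LMCC p) ∧
    (L.RolesSeparated → (L.LMCShared p ↔ L.structureGraph.LMCC p)) ∧
    (L.structureGraph.LMCC p → L.structureGraph.ChainFactorizes p) :=
  ⟨L.lmcOfNames_iff L.namesCompatible_separate hchain hpos hp.2,
    fun h => L.lmcOfNames_iff (L.namesCompatible_shared h) hchain hpos hp.2,
    fun h => h.chainFactorizes hchain hpos hp.2⟩
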